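/- **Setting (the CH$_2$O memory model for C11).** Fix an implementation environment: a totally ordered set $K$ of integer ranks with at least $\mathrm{char}<\mathrm{short}<\mathrm{int}<\mathrm{long}<\mathrm{long\,long}$ and a rank for `size_t`, the number $\mathrm{charbits}\ge 8$ of bits in a byte, integer sizes and encodings, and functions giving size, alignment and field layout of types, subject to the usual laws. *Types.* Types $\tau$ are base types (integers $(\text{sign},k)$ with $k\in K$; pointers; void), arrays $\tau[n]$, structs $\mathsf{struct}\,t$ and unions $\mathsf{union}\,t$. A type environment $\Gamma$ is a finite map giving each declared tag $t$ its list of field types $\Gamma(t)$ and each function name its type. $\Gamma$ is well-formed if it is built up by successively declaring new tags with non-empty lists of already valid field types, and new functions. A memory typing environment $\Delta$ assigns to finitely many object identifiers $o$ a type and a flag "deallocated". *References.* A reference $\vec r$ is a path of segments: element $i$ of a $\tau$-array of length $n$, field $i$ of struct $t$, or variant $i$ of union $t$ with an annotation $q\in\{\text{frozen},\text{unfrozen}\}$ (unfrozen: type-punning allowed). $\Gamma\vdash\vec r:\tau\rightarrowtail\sigma$ means that $\vec r$ leads, within bounds, from type $\tau$ to the type $\sigma$ of a subobject. $\sigma$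 is a *subobject type* of $\tau$, written $\sigma\subseteq_\Gamma\tau$, if $\Gamma\vdash\vec r:\tau\rightarrowtail\sigma$ for some $\vec r$ (possibly empty). *Addresses.* An address $a=(o:\tau,\vec r,i)_{\sigma>\sigma_p}$ consists of an object identifier $o$ of type $\tau$, a reference $\vec r$ to a subobject of type $\sigma$, a byte offset $i$ and a type $\sigma_p$ to which it is cast. It is well-typed of type $\sigma_p$, written $\Gamma,\Delta\vdash a:\sigma_p$, if $\Delta$ gives $o$ the type $\tau$, $\tau$ is valid, $\Gamma\vdash\vec r:\tau\rightarrowtail\sigma$, a final array segment of $\vec r$ has index $0$, $i\le \mathrm{sizeof}(\sigma)\cdot n$ (with $n$ the length of that final array, or $1$), the size of $\sigma_p$ divides $i$, and $\sigma_p$ is $\sigma$, `unsigned char`, or the type of anonymous pointees (`void*`). It is *frozen* if all union annotations in $\vec r$ are frozen. Its normalized reference is $\vec r$ with the index of a final array segment replaced by $i\div\mathrm{sizeof}(\sigma)$, and its normalized byte offset is $i\bmod\mathrm{sizeof}(\sigma)$; it is a byte address if $\sigma_p\ne\sigma$. Two addresses are *disjoint*, written $a_1\perp_\Gamma a_2$,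 if their object identifiers differ; or these agree and the normalized references, up to union annotations, share a common prefix after which they take different elements of the same array or different fields of the same struct; or both are byte addresses with equal object identifiers and, up to annotations, equal normalized references, but different normalized byte offsets. *Memories.* A memory $m$ is a finite map from object identifiers to either the type of a deallocated object or a live object. A live object is a tree following the structure of its type: its leaves are lists of bits with permissions; a union node holds either one specified variant $i$ with its subtree and padding, or just bits, the variant being unspecified. $m$ is *valid* with respect to $\Gamma,\Delta$ if its deallocated and live objects are recorded as such in $\Delta$ with the right type, the types of deallocated objects are valid, the trees of live objects are well-typed, and no live object consists only of indeterminate bits with empty permission. *Operations.* The tree lookup at $a$ follows the normalized reference of $a$ in the tree of the object of $a$ (and takes a single byte if $a$ is a byte address). It fails when the object is not live, the path does not match, or the path selects a variant of a union with a different specified variant through a frozen segment. Through an unfrozen segment it reinterprets the bits of such a union, and through any segment the bits of a union of unspecified variant, provided the permissions are exclusive. The lookup $m\langle a\rangle_\Gamma$ is the value represented by the tree found, or $\bot$ if the tree lookup fails or some of the permissions do not allow reading. The operation $\mathrm{force}_\Gamma\,a\,m$ models the effect of a read access on effective types: it traverses the normalized reference of $a$ and makes the variant it selects the specified variant of each union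 on the way (reinterpreting the bits if the variant changes), leaving the subtree at the end unchanged. The store $m\langle a:=v\rangle_\Gamma$ traverses the tree in the same way and replaces the subtree (or byte) at the end by the representation of $v$ with the old permissions. Both leave $m$ unchanged if the object of $a$ is not live. **Theorem 1 (Strict-aliasing).** Let $\Gamma$ be a well-formed type environment and let $m$ be a memory that is valid with respect to $\Gamma$ and $\Delta$. Let $a_1,a_2$ be frozen addresses with $\Gamma,\Delta\vdash a_1:\sigma_1$ and $\Gamma,\Delta\vdash a_2:\sigma_2$, where $\sigma_1,\sigma_2$ are types different from `unsigned char`. Then at least one of the following holds: 1. $\sigma_1\subseteq_\Gamma\sigma_2$ or $\sigma_2\subseteq_\Gamma\sigma_1$. 2. $a_1\perp_\Gamma a_2$. 3. Accessing $a_1$ after accessing $a_2$, and vice versa, fails. That is: (a) $(\mathrm{force}_\Gamma\,a_2\,m)\langle a_1\rangle_\Gamma=\bot$ and $(\mathrm{force}_\Gamma\,a_1\,m)\langle a_2\rangle_\Gamma=\bot$; and (b) $(m\langle a_2:=v_1\rangle_\Gamma)\langle a_1\rangle_\Gamma=\bot$ and $(m\langle a_1:=v_2\rangle_\Gamma)\langle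 a_2\rangle_\Gamma=\bot$ for all values $v_1$ and $v_2$. -/

import Mathlib

noncomputable section

namespace CH2O

universe u

/-! ### Lists -/

/-- The sublist `x_i … x_{j-1}`. -/
def slice {A : Type*} (i j : ℕ) (l : List A) : List A := (l.take j).drop i

/-- The sublist `x_0 … x_{n-1}`, padded with `y` if the list is too short. -/
def resize {A : Type*} (n : ℕ) (y : A) (l : List A) : List A :=
  l.take n ++ List.replicate (n - l.length) y

/-! ### Types -/

inductive Signedness where
  | signed
  | unsigned

/-- Integer types over a type `K` of integer ranks. -/
structure IntType (K : Type u) where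
  sign : Signedness
  rank : K

/-- Struct/union names. -/
abbrev Tag := String

abbrev FunName := String

mutual
/-- Point-to types. -/
inductive PtrType (K : Type u) : Type u where
  | any : PtrType K
  | func (args : List (Ty K)) (ret : Ty K) : PtrType K
  | type (τ : Ty K) : PtrType K
/-- Base types. -/
inductive BaseType (K : Type u) : Type u where
  | int (τ : IntType K) : BaseType K
  | ptr (τ : PtrType K) : BaseType K
  | void : BaseType K
/-- Full types. -/
inductive Ty (K : Type u) : Type u where
  | base (τ : BaseType K) : Ty K
  | array (τ : Ty K) (n : ℕ) : Ty K
  | struct (t : Tag) : Ty K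
  | union (t : Tag) : Ty K
end

/-- Type environments: finite maps assigning field types to struct/union names, and argument and
return types to function names. -/
structure Env (K : Type u) where
  comps : Finmap (fun _ : Tag => List (Ty K))
  funs : Finmap (fun _ : FunName => List (Ty K) × Ty K)

mutual
/-- Point-to types to which a pointer may point. -/
inductive PtrTypeValid {K : Type u} (Γ : Env K) : PtrType K → Prop where
  | any : PtrTypeValid Γ .any
  | func {τs τ} : (∀ τ' ∈ τs, PtrTypeValid Γ (.type τ')) → PtrTypeValid Γ (.type τ) →
      PtrTypeValid Γ (.func τs τ)
  | base {τb} : BaseTypeValid Γ τb → PtrTypeValid Γ (.type (.base τb))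
  | array {τ n} : TypeValid Γ τ → n ≠ 0 → PtrTypeValid Γ (.type (.array τ n))
  | struct {t} : PtrTypeValid Γ (.type (.struct t))
  | union {t} : PtrTypeValid Γ (.type (.union t))
/-- Valid base types. -/
inductive BaseTypeValid {K : Type u} (Γ : Env K) : BaseType K → Prop where
  | int {τi} : BaseTypeValid Γ (.int τi)
  | ptr {τp} : PtrTypeValid Γ τp → BaseTypeValid Γ (.ptr τp)
  | void : BaseTypeValid Γ .void
/-- Valid types. -/
inductive TypeValid {K : Type u} (Γ : Env K) : Ty K → Prop where
  | base {τb} : BaseTypeValid Γ τb → TypeValid Γ (.base τb)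
  | array {τ n} : TypeValid Γ τ → n ≠ 0 → TypeValid Γ (.array τ n)
  | struct {t} : t ∈ Γ.comps → TypeValid Γ (.struct t)
  | union {t} : t ∈ Γ.comps → TypeValid Γ (.union t)
end

/-- Well-formed type environments. -/
inductive EnvValid {K : Type u} : Env K → Prop where
  | empty : EnvValid ⟨∅, ∅⟩
  | comp {Γ : Env K} {t : Tag} {τs : List (Ty K)} :
      EnvValid Γ → (∀ τ ∈ τs, TypeValid Γ τ) → τs ≠ [] → t ∉ Γ.comps →
      EnvValid ⟨Γ.comps.insert t τs, Γ.funs⟩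
  | func {Γ : Env K} {f : FunName} {τs : List (Ty K)} {τ : Ty K} :
      EnvValid Γ → (∀ τ' ∈ τs, PtrTypeValid Γ (.type τ')) → PtrTypeValid Γ (.type τ) →
      f ∉ Γ.funs → EnvValid ⟨Γ.comps, Γ.funs.insert f (τs, τ)⟩

/-- Inclusion of type environments: `Γ₂` is a weakening of `Γ₁`. -/
def Env.Sub {K : Type u} (Γ₁ Γ₂ : Env K) : Prop :=
  (∀ t τs, Γ₁.comps.lookup t = some τs → Γ₂.comps.lookup t = some τs) ∧
  (∀ f τ, Γ₁.funs.lookup f = some τ → Γ₂.funs.lookup f = some τ)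

/-! ### Implementation environments -/

/-- Integer coding environments with ranks `K`. -/
class IntEnv (K : Type u) [LinearOrder K] where
  charRank : K
  shortRank : K
  intRank : K
  longRank : K
  longlongRank : K
  sizeRank : K
  char_lt_short : charRank < shortRank
  short_lt_int : shortRank < intRank
  int_lt_long : intRank < longRank
  long_lt_longlong : longRank < longlongRank
  charBits : ℕ
  eight_le_charBits : 8 ≤ charBits
  charSignedness : Signedness
  rankSize : K → ℕ
  rankSize_pos : ∀ k, 0 < rankSize k
  rankSize_mono : Monotone rankSize
  rankSize_char : rankSize charRank = 1
  endianize : K → List Bool → List Bool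
  deendianize : K → List Bool → List Bool
  deendianize_endianize : ∀ k βs, deendianize k (endianize k βs) = βs
  endianize_deendianize : ∀ k βs, endianize k (deendianize k βs) = βs
  endianize_perm : ∀ k βs, (endianize k βs).Perm βs

/-- Implementation environments with ranks `K`: sizes, alignments and the layout of the fields of
structs. The partial sums `((fieldSizes Γ τs).take i).sum` are the field offsets. -/
class ImplEnv (K : Type u) [LinearOrder K] extends IntEnv K where
  sizeof : Env K → Ty K → ℕ
  alignof : Env K → Ty K → ℕ
  fieldSizes : Env K → List (Ty K) → List ℕ
  sizeof_int : ∀ Γ τi, sizeof Γ (.base (.int τi)) = rankSize τi.rank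
  sizeof_ptr : ∀ Γ τp, sizeof Γ (.base (.ptr τp)) ≠ 0
  sizeof_void : ∀ Γ, sizeof Γ (.base .void) ≠ 0
  sizeof_array : ∀ Γ τ n, sizeof Γ (.array τ n) = n * sizeof Γ τ
  sizeof_struct : ∀ Γ t τs, EnvValid Γ → Γ.comps.lookup t = some τs →
    sizeof Γ (.struct t) = (fieldSizes Γ τs).sum
  length_fieldSizes : ∀ Γ τs, EnvValid Γ → (fieldSizes Γ τs).length = τs.length
  sizeof_field : ∀ Γ τs, EnvValid Γ → ∀ (i : ℕ) τ z, τs[i]? = some τ →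
    (fieldSizes Γ τs)[i]? = some z → sizeof Γ τ ≤ z
  sizeof_union : ∀ Γ t τs, EnvValid Γ → Γ.comps.lookup t = some τs →
    ∀ τ ∈ τs, sizeof Γ τ ≤ sizeof Γ (.union t)
  alignof_array : ∀ Γ τ n, alignof Γ τ ∣ alignof Γ (.array τ n)
  alignof_struct : ∀ Γ t τs, EnvValid Γ → Γ.comps.lookup t = some τs →
    ∀ τ ∈ τs, alignof Γ τ ∣ alignof Γ (.struct t)
  alignof_union : ∀ Γ t τs, EnvValid Γ → Γ.comps.lookup t = some τs →
    ∀ τ ∈ τs, alignof Γ τ ∣ alignof Γ (.union t)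
  alignof_sizeof : ∀ Γ τ, EnvValid Γ → TypeValid Γ τ → alignof Γ τ ∣ sizeof Γ τ
  alignof_offset : ∀ Γ τs, EnvValid Γ → (∀ τ ∈ τs, TypeValid Γ τ) →
    ∀ (i : ℕ) τ, τs[i]? = some τ → alignof Γ τ ∣ ((fieldSizes Γ τs).take i).sum
  sizeof_weaken : ∀ Γ₁ Γ₂ τ, EnvValid Γ₁ → EnvValid Γ₂ → TypeValid Γ₁ τ → Γ₁.Sub Γ₂ →
    sizeof Γ₁ τ = sizeof Γ₂ τ
  alignof_weaken : ∀ Γ₁ Γ₂ τ, EnvValid Γ₁ → EnvValid Γ₂ → TypeValid Γ₁ τ → Γ₁.Sub Γ₂ →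
    alignof Γ₁ τ = alignof Γ₂ τ
  fieldSizes_weaken : ∀ Γ₁ Γ₂ τs, EnvValid Γ₁ → EnvValid Γ₂ → (∀ τ ∈ τs, TypeValid Γ₁ τ) →
    Γ₁.Sub Γ₂ → fieldSizes Γ₁ τs = fieldSizes Γ₂ τs

section Sizes

variable {K : Type u} [LinearOrder K] [ImplEnv K]

/-- The type `unsigned char`. -/
def ucharInt : IntType K := ⟨.unsigned, IntEnv.charRank⟩

/-- The type `unsigned char`, as a full type. -/
def uchar : Ty K := .base (.int ucharInt)

variable (K) in
def charBits : ℕ := IntEnv.charBits K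

def bitSizeof (Γ : Env K) (τ : Ty K) : ℕ := ImplEnv.sizeof Γ τ * charBits K

def fieldBitSizes (Γ : Env K) (τs : List (Ty K)) : List ℕ :=
  (ImplEnv.fieldSizes Γ τs).map (· * charBits K)

/-- The bit offset of the `i`th field of a struct with fields `τs`. -/
def bitOffsetof (Γ : Env K) (τs : List (Ty K)) (i : ℕ) : ℕ := ((fieldBitSizes Γ τs).take i).sum

/-- The byte size of the objects a pointer of the given type steps over: a pointer to an
object of unspecified type addresses single bytes. -/
def ptrSizeof (Γ : Env K) : PtrType K → ℕ
  | .type τ => ImplEnv.sizeof Γ τ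
  | _ => 1

/-- Number of bits of an integer type. -/
def IntType.width (τ : IntType K) : ℕ := charBits K * IntEnv.rankSize τ.rank

/-- Two's complement encoding of an integer, with the bits ordered as the implementation does. -/
def intToBits (τ : IntType K) (x : ℤ) : List Bool :=
  IntEnv.endianize τ.rank ((List.range τ.width).map fun i => x.testBit i)

/-- The natural number with the given binary digits, least significant first. -/
def natOfBits : List Bool → ℕ
  | [] => 0
  | β :: βs => β.toNat + 2 * natOfBits βs

/-- Two's complement decoding. -/
def intOfBits (τ : IntType K) (βs : List Bool) : ℤ :=
  let βs' := IntEnv.deendianize τ.rank βs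
  match τ.sign, βs'.getLast? with
  | .signed, some true => (natOfBits βs' : ℤ) - 2 ^ βs'.length
  | _, _ => natOfBits βs'

end Sizes

/-! ### Permissions -/

inductive LockStatus where
  | locked
  | unlocked

/-- Permissions: lockable counting fractional permissions (for objects that are not `const`
qualified), or fractional permissions (for `const` qualified objects). -/
inductive Perm where
  | rw (l : LockStatus) (count : ℚ) (frac : ℚ)
  | const (frac : ℚ)

inductive PermKind where
  | existing
  | readable
  | locked
  | writable

/-- The lattice order on permission kinds, `none` being the kind that allows no operation. -/
inductive PermKind.Le : Option PermKind → Option PermKind → Prop where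
  | none {k} : Le none k
  | refl {k} : Le k k
  | existing {k} : Le (some .existing) (some k)
  | writable {k} : Le (some k) (some .writable)

namespace Perm

/-- The empty permission. -/
def empty : Perm := .rw .unlocked 0 0

/-- A permission without an actual share may only carry a non-positive count (it stands for
existence permissions that have been handed out), and one with the full share only a non-negative
count. Only full shares can be locked. The empty permission is not `const`. -/
def Valid : Perm → Prop
  | .rw .unlocked x y => 0 ≤ y ∧ y ≤ 1 ∧ (y = 0 → x ≤ 0) ∧ (y = 1 → 0 ≤ x)
  | .rw .locked x y => y = 1 ∧ 0 ≤ x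
  | .const y => 0 < y ∧ y ≤ 1

/-- Unmapped permissions: those that do not allow their bit to be used in any way. -/
def Unmapped : Perm → Prop
  | .rw .unlocked x y => y = 0 ∧ x ≤ 0
  | .rw .locked _ _ => False
  | .const _ => False

/-- Unshared (exclusive) permissions: those that are the sole owner of their bit, i.e. that are
disjoint from unmapped permissions only. -/
def Unshared : Perm → Prop
  | .rw _ x y => y = 1 ∧ 0 ≤ x
  | .const y => y = 1

/-- The kind of a permission. -/
def kind : Perm → Option PermKind
  | .rw .locked _ _ => some .locked
  | .rw .unlocked x y =>
      if y = 0 then (if x = 0 then none else some .existing)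
      else if y = 1 then some .writable else some .readable
  | .const y => if y = 0 then none else some .readable

end Perm

/-! ### References, addresses and pointers -/

/-- Object identifiers, a fixed countable set. -/
abbrev ObjId := ℕ

/-- Memory typing environments: each object identifier has a type, and a Boolean that tells whether
the object has been deallocated. -/
abbrev MemEnv (K : Type u) := Finmap (fun _ : ObjId => Ty K × Bool)

def IndexTyped {K : Type u} (Δ : MemEnv K) (o : ObjId) (τ : Ty K) : Prop :=
  ∃ β, Δ.lookup o = some (τ, β)

def IndexAlive {K : Type u} (Δ : MemEnv K) (o : ObjId) : Prop :=
  ∃ τ, Δ.lookup o = some (τ, false)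

/-- Annotations on union segments of references: type-punning is allowed iff `unfrozen`. -/
inductive Frozenness where
  | frozen
  | unfrozen

/-- Reference segments. -/
inductive RefSeg (K : Type u) where
  /-- The `i`th element of a `τ`-array of length `n`. -/
  | array (i : ℕ) (τ : Ty K) (n : ℕ)
  /-- The `i`th field of the struct `t`. -/
  | struct (i : ℕ) (t : Tag)
  /-- The `i`th variant of the union `t`. -/
  | union (i : ℕ) (t : Tag) (q : Frozenness)

/-- References: paths from the top of an object (head of the list) to a subobject. -/
abbrev Ref (K : Type u) := List (RefSeg K)

/-- Addresses. -/
structure Addr (K : Type u) where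
  /-- the object identifier -/
  index : ObjId
  /-- the type of the whole object -/
  objTy : Ty K
  /-- a reference to a subobject -/
  ref : Ref K
  /-- the byte offset in that subobject (or in the array of which it is the first element) -/
  byte : ℕ
  /-- the type of that subobject -/
  subTy : Ty K
  /-- the type to which the address has been cast -/
  castTy : PtrType K

/-- Pointers. -/
inductive Ptr (K : Type u) where
  | null (τ : PtrType K)
  | addr (a : Addr K)
  | func (f : FunName) (args : List (Ty K)) (ret : Ty K)

def RefSeg.freeze {K : Type u} : RefSeg K → RefSeg K
  | .array i τ n => .array i τ n
  | .struct i t => .struct i t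
  | .union i t _ => .union i t .frozen

def Ref.freeze {K : Type u} (r : Ref K) : Ref K := r.map RefSeg.freeze

def Addr.freeze {K : Type u} (a : Addr K) : Addr K := { a with ref := Ref.freeze a.ref }

def Ptr.freeze {K : Type u} : Ptr K → Ptr K
  | .null τ => .null τ
  | .addr a => .addr a.freeze
  | .func f τs τ => .func f τs τ

def Addr.Frozen {K : Type u} (a : Addr K) : Prop := a.freeze = a

def Ptr.Frozen {K : Type u} (p : Ptr K) : Prop := p.freeze = p

/-- The point-to type of a pointer. -/
def Ptr.typeOf {K : Type u} : Ptr K → PtrType K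
  | .null τ => τ
  | .addr a => a.castTy
  | .func _ τs τ => .func τs τ

/-- `RefTyped Γ r τ σ`: `r` is a valid reference from `τ` to its subobject type `σ`. -/
inductive RefTyped {K : Type u} (Γ : Env K) : Ref K → Ty K → Ty K → Prop where
  | nil {τ} : RefTyped Γ [] τ τ
  | array {r τ σ n i} : RefTyped Γ r τ (.array σ n) → i < n →
      RefTyped Γ (r ++ [.array i σ n]) τ σ
  | struct {r τ t σs σ} {i : ℕ} : RefTyped Γ r τ (.struct t) → Γ.comps.lookup t = some σs →
      σs[i]? = some σ → RefTyped Γ (r ++ [.struct i t]) τ σ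
  | union {r τ t σs σ q} {i : ℕ} : RefTyped Γ r τ (.union t) → Γ.comps.lookup t = some σs →
      σs[i]? = some σ → RefTyped Γ (r ++ [.union i t q]) τ σ

/-- `SubobjectType Γ τ σ`: `τ` is a subobject type of `σ`. -/
def SubobjectType {K : Type u} (Γ : Env K) (τ σ : Ty K) : Prop := ∃ r : Ref K, RefTyped Γ r σ τ

def Ref.offset {K : Type u} (r : Ref K) : ℕ :=
  match r.getLast? with
  | some (.array i _ _) => i
  | _ => 0

def Ref.size {K : Type u} (r : Ref K) : ℕ :=
  match r.getLast? with
  | some (.array _ _ n) => n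
  | _ => 1

def Ref.setOffset {K : Type u} (j : ℕ) (r : Ref K) : Ref K :=
  match r.getLast? with
  | some (.array _ τ n) => r.dropLast ++ [.array j τ n]
  | _ => r

/-- Disjointness of references: they take a different branch at an array or a struct. -/
inductive Ref.Disjoint {K : Type u} : Ref K → Ref K → Prop where
  | array {r₁ r₂ r₃ r₄ : Ref K} {i j : ℕ} {σ : Ty K} {n : ℕ} :
      Ref.freeze r₁ = Ref.freeze r₂ → i ≠ j →
      Ref.Disjoint (r₁ ++ .array i σ n :: r₃) (r₂ ++ .array j σ n :: r₄)
  | struct {r₁ r₂ r₃ r₄ : Ref K} {i j : ℕ} {t : Tag} :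
      Ref.freeze r₁ = Ref.freeze r₂ → i ≠ j →
      Ref.Disjoint (r₁ ++ .struct i t :: r₃) (r₂ ++ .struct j t :: r₄)

/-- A byte address refers to an individual byte instead of an entire subobject. -/
def Addr.IsByte {K : Type u} (a : Addr K) : Prop := PtrType.type a.subTy ≠ a.castTy

section Addresses

variable {K : Type u} [LinearOrder K] [ImplEnv K]

/-- `Castable τ σp`: the type `τ` is pointer castable to `σp`. -/
inductive Castable : Ty K → PtrType K → Prop where
  | self {τ} : Castable τ (.type τ)
  | uchar {τ} : Castable τ (.type uchar)
  | any {τ} : Castable τ .any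

/-- `AddrTyped Γ Δ a σp`: the address `a` refers to type `σp`. -/
def AddrTyped (Γ : Env K) (Δ : MemEnv K) (a : Addr K) (σp : PtrType K) : Prop :=
  IndexTyped Δ a.index a.objTy ∧ TypeValid Γ a.objTy ∧ RefTyped Γ a.ref a.objTy a.subTy ∧
  Ref.offset a.ref = 0 ∧ a.byte ≤ ImplEnv.sizeof Γ a.subTy * Ref.size a.ref ∧
  ptrSizeof Γ a.castTy ∣ a.byte ∧ Castable a.subTy a.castTy ∧ a.castTy = σp

/-- `PtrTyped Γ Δ p σp`: the pointer `p` refers to type `σp`. -/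
inductive PtrTyped (Γ : Env K) (Δ : MemEnv K) : Ptr K → PtrType K → Prop where
  | null {σp} : PtrTypeValid Γ σp → PtrTyped Γ Δ (.null σp) σp
  | addr {a σp} : AddrTyped Γ Δ a σp → PtrTyped Γ Δ (.addr a) σp
  | func {f τs τ} : Γ.funs.lookup f = some (τs, τ) → PtrTyped Γ Δ (.func f τs τ) (.func τs τ)

/-- The normalized reference, which refers to the actual array element. -/
def Addr.nref (Γ : Env K) (a : Addr K) : Ref K :=
  Ref.setOffset (a.byte / ImplEnv.sizeof Γ a.subTy) a.ref

/-- The normalized byte offset. -/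
def Addr.nbyte (Γ : Env K) (a : Addr K) : ℕ := a.byte % ImplEnv.sizeof Γ a.subTy

/-- Disjointness of addresses. -/
inductive Addr.Disjoint (Γ : Env K) : Addr K → Addr K → Prop where
  | index {a₁ a₂} : a₁.index ≠ a₂.index → Addr.Disjoint Γ a₁ a₂
  | ref {a₁ a₂} : a₁.index = a₂.index → Ref.Disjoint (a₁.nref Γ) (a₂.nref Γ) →
      Addr.Disjoint Γ a₁ a₂
  | byte {a₁ a₂} : a₁.IsByte → a₂.IsByte → a₁.index = a₂.index →
      Ref.freeze (a₁.nref Γ) = Ref.freeze (a₂.nref Γ) → a₁.nbyte Γ ≠ a₂.nbyte Γ →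
      Addr.Disjoint Γ a₁ a₂

end Addresses

/-! ### Bits -/

/-- Bits: indeterminate, concrete, or the `i`th fragment of a pointer. -/
inductive Bit (K : Type u) where
  | indet
  | bit (β : Bool)
  | ptrSeg (p : Ptr K) (i : ℕ)

/-- The value of a concrete bit. -/
def Bit.toBool? {K : Type u} : Bit K → Option Bool
  | .bit β => some β
  | _ => none

open Classical in
/-- The join of bits, meaningful if the bits are equal or one of them is indeterminate. -/
def Bit.join {K : Type u} (b₁ b₂ : Bit K) : Bit K := if b₁ = .indet then b₂ else b₁

/-- Permission annotated bits. -/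
abbrev PBit (K : Type u) := Perm × Bit K

namespace PBit

variable {K : Type u}

def indetify (b : PBit K) : PBit K := (b.1, .indet)

def Unmapped (b : PBit K) : Prop := b.1.Unmapped ∧ b.2 = .indet

def Unshared (b : PBit K) : Prop := b.1.Unshared

end PBit

section Bits

variable {K : Type u} [LinearOrder K] [ImplEnv K]

/-- Valid bits. -/
inductive BitValid (Γ : Env K) (Δ : MemEnv K) : Bit K → Prop where
  | indet : BitValid Γ Δ .indet
  | bit {β} : BitValid Γ Δ (.bit β)
  | ptrSeg {p σp i} : PtrTyped Γ Δ p σp → p.Frozen → i < bitSizeof Γ (.base (.ptr σp)) →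
      BitValid Γ Δ (.ptrSeg p i)

/-- Valid permission annotated bits. -/
def PBitValid (Γ : Env K) (Δ : MemEnv K) (b : PBit K) : Prop :=
  BitValid Γ Δ b.2 ∧ b.1.Valid ∧ (b.1.Unmapped → b.2 = .indet)

end Bits

/-! ### Memory trees and memories -/

/-- Memory trees. -/
inductive MTree (K : Type u) : Type u where
  | base (τ : BaseType K) (bs : List (PBit K)) : MTree K
  | array (τ : Ty K) (ws : List (MTree K)) : MTree K
  /-- A struct: the memory trees of the fields, each with the padding after it. -/
  | struct (t : Tag) (fs : List (MTree K × List (PBit K))) : MTree K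
  /-- A union of variant `i`, with the padding after the element. -/
  | union (t : Tag) (i : ℕ) (w : MTree K) (bs : List (PBit K)) : MTree K
  /-- A union whose variant is unspecified. -/
  | unionAll (t : Tag) (bs : List (PBit K)) : MTree K

def MTree.typeOf {K : Type u} : MTree K → Ty K
  | .base τ _ => .base τ
  | .array τ ws => .array τ ws.length
  | .struct t _ => .struct t
  | .union t _ _ _ => .union t
  | .unionAll t _ => .union t

mutual
/-- The bits of a memory tree, including the padding. -/
def MTree.flatten {K : Type u} : MTree K → List (PBit K)
  | .base _ bs => bs
  | .array _ ws => MTree.flattenList ws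
  | .struct _ fs => MTree.flattenFields fs
  | .union _ _ w bs => w.flatten ++ bs
  | .unionAll _ bs => bs
def MTree.flattenList {K : Type u} : List (MTree K) → List (PBit K)
  | [] => []
  | w :: ws => w.flatten ++ MTree.flattenList ws
def MTree.flattenFields {K : Type u} : List (MTree K × List (PBit K)) → List (PBit K)
  | [] => []
  | (w, bs) :: fs => w.flatten ++ bs ++ MTree.flattenFields fs
end

/-- Objects in memory: deallocated ones, of which only the type is kept, and live ones, with a
Boolean that tells whether the object has been allocated by `malloc`. -/
inductive MemObj (K : Type u) where
  | freed (τ : Ty K)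
  | live (w : MTree K) (μ : Bool)

/-- Memories. -/
abbrev Mem (K : Type u) := Finmap (fun _ : ObjId => MemObj K)

section MemTyping

variable {K : Type u} [LinearOrder K] [ImplEnv K]

/-- `MTreeTyped Γ Δ w τ`: the memory tree `w` has type `τ`. -/
inductive MTreeTyped (Γ : Env K) (Δ : MemEnv K) : MTree K → Ty K → Prop where
  | base {τb bs} : BaseTypeValid Γ τb → (∀ b ∈ bs, PBitValid Γ Δ b) →
      bs.length = bitSizeof Γ (.base τb) → MTreeTyped Γ Δ (.base τb bs) (.base τb)
  | array {τ n} {ws : List (MTree K)} : (∀ w ∈ ws, MTreeTyped Γ Δ w τ) → ws.length = n → n ≠ 0 →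
      MTreeTyped Γ Δ (.array τ ws) (.array τ n)
  | struct {t τs} {fs : List (MTree K × List (PBit K))} :
      Γ.comps.lookup t = some τs → fs.length = τs.length →
      (∀ (i : ℕ) w bs τ, fs[i]? = some (w, bs) → τs[i]? = some τ → MTreeTyped Γ Δ w τ) →
      (∀ (i : ℕ) w bs τ z, fs[i]? = some (w, bs) → τs[i]? = some τ →
        (fieldBitSizes Γ τs)[i]? = some z →
        (∀ b ∈ bs, PBitValid Γ Δ b ∧ b.2 = .indet) ∧ bs.length = z - bitSizeof Γ τ) →
      MTreeTyped Γ Δ (.struct t fs) (.struct t)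
  | union {t τs τ w bs} {i : ℕ} :
      Γ.comps.lookup t = some τs → τs[i]? = some τ → MTreeTyped Γ Δ w τ →
      (∀ b ∈ bs, PBitValid Γ Δ b ∧ b.2 = .indet) →
      bitSizeof Γ (.union t) = bitSizeof Γ τ + bs.length →
      (¬ ∀ b ∈ w.flatten ++ bs, PBit.Unmapped b) →
      MTreeTyped Γ Δ (.union t i w bs) (.union t)
  | unionAll {t τs bs} :
      Γ.comps.lookup t = some τs → (∀ b ∈ bs, PBitValid Γ Δ b) →
      bs.length = bitSizeof Γ (.union t) → MTreeTyped Γ Δ (.unionAll t bs) (.union t)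

/-- `MemValid Γ Δ m`: the memory `m` is valid. -/
def MemValid (Γ : Env K) (Δ : MemEnv K) (m : Mem K) : Prop :=
  (∀ o τ, m.lookup o = some (.freed τ) →
    IndexTyped Δ o τ ∧ ¬ IndexAlive Δ o ∧ TypeValid Γ τ) ∧
  (∀ o w μ, m.lookup o = some (.live w μ) →
    ∃ τ, IndexTyped Δ o τ ∧ IndexAlive Δ o ∧ MTreeTyped Γ Δ w τ ∧
      ¬ ∀ b ∈ w.flatten, b = (Perm.empty, Bit.indet))

end MemTyping

/-! ### Operations on memory trees and memories -/

/-- Removing a declared name from the finite map of structs and unions makes it smaller: the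
measure by which recursion over the fields of structs and unions terminates. -/
theorem card_keys_erase_lt {A : Type*} {C : Finmap (fun _ : Tag => A)} {t : Tag} {x : A}
    (h : C.lookup t = some x) : (C.erase t).keys.card < C.keys.card := by
  rw [Finmap.keys_erase]
  apply Finset.card_erase_lt_of_mem
  rw [Finmap.mem_keys, ← Finmap.lookup_isSome, h]
  rfl

section MemOps

variable {K : Type u} [LinearOrder K] [ImplEnv K]

/-- Interpret bits as a memory tree of a given type. The recursion looks up the fields of structs
in `C`, from which the names of the enclosing structs have been removed. As struct declarations
in a well-formed environment are not cyclic, such names do not occur again. -/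
def unflattenAux (Γ : Env K) (C : Finmap (fun _ : Tag => List (Ty K))) :
    Ty K → List (PBit K) → MTree K
  | .base τb, bs => .base τb bs
  | .array τ n, bs =>
      .array τ ((List.range n).map fun i =>
        unflattenAux Γ C τ (slice (i * bitSizeof Γ τ) ((i + 1) * bitSizeof Γ τ) bs))
  | .struct t, bs =>
      match _h : C.lookup t with
      | none => .struct t []
      | some τs => .struct t (τs.mapIdx fun i τ =>
          (unflattenAux Γ (C.erase t) τ
            (slice (bitOffsetof Γ τs i) (bitOffsetof Γ τs i + bitSizeof Γ τ) bs),
           (slice (bitOffsetof Γ τs i + bitSizeof Γ τ) (bitOffsetof Γ τs (i + 1)) bs).map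
            PBit.indetify))
  | .union t, bs => .unionAll t bs
termination_by τ => (C.keys.card, sizeOf τ)
decreasing_by
  · exact Prod.Lex.right _ (by simp +arith)
  · exact Prod.Lex.left _ _ (card_keys_erase_lt _h)

/-- The unflatten operation on memory trees. -/
def unflatten (Γ : Env K) (τ : Ty K) (bs : List (PBit K)) : MTree K := unflattenAux Γ Γ.comps τ bs

/-- The type of the `i`th field or variant of a struct or union. -/
def Env.field (Γ : Env K) (t : Tag) (i : ℕ) : Option (Ty K) :=
  (Γ.comps.lookup t).bind fun τs => τs[i]?

open Classical in
/-- One step of the lookup operation on memory trees. -/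
def MTree.lookupSeg (Γ : Env K) : RefSeg K → MTree K → Option (MTree K)
  | .array i τ _, .array τ' ws => if τ = τ' then ws[i]? else none
  | .struct i t, .struct t' fs => if t = t' then fs[i]?.map Prod.fst else none
  | .union i t q, .union t' j w bs =>
      if t = t' then
        if i = j then some w
        else match q with
          | .frozen => none
          | .unfrozen =>
              if ∀ b ∈ w.flatten ++ bs, PBit.Unshared b then
                (Γ.field t i).map fun τ =>
                  unflatten Γ τ (slice 0 (bitSizeof Γ τ) (w.flatten ++ bs))
              else none
      else none
  | .union i t _, .unionAll t' bs =>
      if t = t' ∧ ∀ b ∈ bs, PBit.Unshared b then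
        (Γ.field t i).map fun τ => unflatten Γ τ (slice 0 (bitSizeof Γ τ) bs)
      else none
  | _, _ => none

/-- The lookup operation on memory trees. -/
def MTree.lookup (Γ : Env K) : Ref K → MTree K → Option (MTree K)
  | [], w => some w
  | s :: r, w => (MTree.lookupSeg Γ s w).bind (MTree.lookup Γ r)

open Classical in
/-- One step of the alter operation on memory trees: apply `g` to the subtree selected by the
segment, after making the selected variant the current one in case of a union. The result is only
meaningful if the segment selects a subtree. -/
def MTree.alterSeg (Γ : Env K) (g : MTree K → MTree K) : RefSeg K → MTree K → MTree K
  | .array i τ _, .array τ' ws =>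
      if τ = τ' then .array τ' (ws.modify i g) else MTree.array τ' ws
  | .struct i t, .struct t' fs =>
      if t = t' then .struct t' (fs.modify i fun f => (g f.1, f.2)) else MTree.struct t' fs
  | .union i t _, .union t' j w bs =>
      if t = t' then
        if i = j then .union t' i (g w) bs
        else match Γ.field t i with
          | some τ =>
              .union t' i (g (unflatten Γ τ (slice 0 (bitSizeof Γ τ) (w.flatten ++ bs))))
                (slice (bitSizeof Γ τ) (bitSizeof Γ (.union t))
                  ((w.flatten ++ bs).map PBit.indetify))
          | none => .union t' j w bs
      else .union t' j w bs
  | .union i t _, .unionAll t' bs =>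
      if t = t' then
        match Γ.field t i with
        | some τ =>
            .union t' i (g (unflatten Γ τ (slice 0 (bitSizeof Γ τ) bs)))
              (slice (bitSizeof Γ τ) (bitSizeof Γ (.union t)) (bs.map PBit.indetify))
        | none => .unionAll t' bs
      else .unionAll t' bs
  | _, w => w

/-- The alter operation on memory trees. -/
def MTree.alter (Γ : Env K) (f : MTree K → MTree K) : Ref K → MTree K → MTree K
  | [], w => f w
  | s :: r, w => MTree.alterSeg Γ (MTree.alter Γ f r) s w

open Classical in
/-- The lookup operation on memories, yielding a memory tree. It fails in particular at an array
index past the end, because the normalized reference then selects no element. -/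
def Mem.treeLookup (Γ : Env K) (a : Addr K) (m : Mem K) : Option (MTree K) :=
  match m.lookup a.index with
  | some (.live w _) =>
      if a.IsByte then
        (MTree.lookup Γ (a.nref Γ) w).map fun w' =>
          unflatten Γ uchar
            (slice (a.nbyte Γ * charBits K) ((a.nbyte Γ + 1) * charBits K) w'.flatten)
      else MTree.lookup Γ (a.nref Γ) w
  | _ => none

/-- Apply `f` to the bits `i`, …, `j - 1` of a memory tree, interpreted as an `unsigned char`. -/
def MTree.alterByte (Γ : Env K) (f : MTree K → MTree K) (i j : ℕ) (w : MTree K) : MTree K :=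
  unflatten Γ w.typeOf
    (slice 0 i w.flatten ++ (f (unflatten Γ uchar (slice i j w.flatten))).flatten ++
      slice j (bitSizeof Γ w.typeOf) w.flatten)

open Classical in
/-- The alter operation on memories. -/
def Mem.alter (Γ : Env K) (f : MTree K → MTree K) (a : Addr K) (m : Mem K) : Mem K :=
  match m.lookup a.index with
  | some (.live w μ) =>
      if a.IsByte then
        m.insert a.index (.live (MTree.alter Γ
          (MTree.alterByte Γ f (a.nbyte Γ * charBits K) ((a.nbyte Γ + 1) * charBits K))
          (a.nref Γ) w) μ)
      else m.insert a.index (.live (MTree.alter Γ f (a.nref Γ) w) μ)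
  | _ => m

end MemOps

/-! ### Values -/

/-- Base values. -/
inductive BaseVal (K : Type u) where
  | indet (τ : BaseType K)
  | void
  | int (τ : IntType K) (x : ℤ)
  | ptr (p : Ptr K)
  | byte (bs : List (Bit K))

/-- Abstract values. -/
inductive Val (K : Type u) : Type u where
  | base (v : BaseVal K) : Val K
  | array (τ : Ty K) (vs : List (Val K)) : Val K
  | struct (t : Tag) (vs : List (Val K)) : Val K
  | union (t : Tag) (i : ℕ) (v : Val K) : Val K
  /-- A union of unspecified variant, with the interpretations of all its variants. -/
  | unionAll (t : Tag) (vs : List (Val K)) : Val K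

section Values

variable {K : Type u} [LinearOrder K] [ImplEnv K]

def BaseVal.typeOf : BaseVal K → BaseType K
  | .indet τ => τ
  | .void => .void
  | .int τ _ => .int τ
  | .ptr p => .ptr p.typeOf
  | .byte _ => .int ucharInt

def Val.typeOf : Val K → Ty K
  | .base v => .base v.typeOf
  | .array τ vs => .array τ vs.length
  | .struct t _ => .struct t
  | .union t _ _ => .union t
  | .unionAll t _ => .union t

/-- The sequence of all fragments of a pointer of type `σp`. -/
def ptrBits (Γ : Env K) (p : Ptr K) (σp : PtrType K) : List (Bit K) :=
  (List.range (bitSizeof Γ (.base (.ptr σp)))).map fun i => .ptrSeg p i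

/-- The flatten operation on base values. Pointers are frozen. -/
def BaseVal.flatten (Γ : Env K) : BaseVal K → List (Bit K)
  | .indet τ => List.replicate (bitSizeof Γ (.base τ)) .indet
  | .void => List.replicate (bitSizeof Γ (.base .void)) .indet
  | .int τ x => (intToBits τ x).map .bit
  | .ptr p => ptrBits Γ p.freeze p.typeOf
  | .byte bs => bs

open Classical in
/-- The unflatten operation on base values. -/
def BaseVal.unflatten (Γ : Env K) : BaseType K → List (Bit K) → BaseVal K
  | .void, _ => .void
  | .int τ, bs =>
      match bs.mapM Bit.toBool? with
      | some βs => .int τ (intOfBits τ βs)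
      | none =>
          if τ = ucharInt ∧ ¬ ∀ b ∈ bs, b = .indet then .byte bs else .indet (.int τ)
  | .ptr σp, bs =>
      match bs.head? with
      | some (.ptrSeg p _) =>
          if bs = ptrBits Γ p σp ∧ p.typeOf = σp then .ptr p else .indet (.ptr σp)
      | _ => .indet (.ptr σp)

/-- Interpret bits as a value of a given type. The recursion is the one of `unflattenAux`. -/
def Val.unflattenAux (Γ : Env K) (C : Finmap (fun _ : Tag => List (Ty K))) :
    Ty K → List (Bit K) → Val K
  | .base τb, bs => .base (BaseVal.unflatten Γ τb bs)
  | .array τ n, bs =>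
      .array τ ((List.range n).map fun i =>
        Val.unflattenAux Γ C τ (slice (i * bitSizeof Γ τ) ((i + 1) * bitSizeof Γ τ) bs))
  | .struct t, bs =>
      match _h : C.lookup t with
      | none => .struct t []
      | some τs => .struct t (τs.mapIdx fun i τ =>
          Val.unflattenAux Γ (C.erase t) τ
            (slice (bitOffsetof Γ τs i) (bitOffsetof Γ τs i + bitSizeof Γ τ) bs))
  | .union t, bs =>
      match _h : C.lookup t with
      | none => .unionAll t []
      | some τs => .unionAll t (τs.map fun τ =>
          Val.unflattenAux Γ (C.erase t) τ (slice 0 (bitSizeof Γ τ) bs))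
termination_by τ => (C.keys.card, sizeOf τ)
decreasing_by
  · exact Prod.Lex.right _ (by simp +arith)
  · exact Prod.Lex.left _ _ (card_keys_erase_lt _h)
  · exact Prod.Lex.left _ _ (card_keys_erase_lt _h)

/-- The unflatten operation on values. -/
def Val.unflatten (Γ : Env K) (τ : Ty K) (bs : List (Bit K)) : Val K :=
  Val.unflattenAux Γ Γ.comps τ bs

mutual
/-- The flatten operation on values. Padding is made of indeterminate bits. -/
def Val.flatten (Γ : Env K) : Val K → List (Bit K)
  | .base v => v.flatten Γ
  | .array _ vs => Val.flattenList Γ vs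
  | .struct t vs =>
      Val.flattenFields Γ (fieldBitSizes Γ ((Γ.comps.lookup t).getD [])) vs
  | .union t _ v => resize (bitSizeof Γ (.union t)) .indet (Val.flatten Γ v)
  | .unionAll t vs => Val.flattenJoin Γ (bitSizeof Γ (.union t)) vs
/-- The concatenation of the flattened values. -/
def Val.flattenList (Γ : Env K) : List (Val K) → List (Bit K)
  | [] => []
  | v :: vs => Val.flatten Γ v ++ Val.flattenList Γ vs
/-- The concatenation of the flattened values, padded to the given sizes. -/
def Val.flattenFields (Γ : Env K) : List ℕ → List (Val K) → List (Bit K)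
  | z :: zs, v :: vs => resize z .indet (Val.flatten Γ v) ++ Val.flattenFields Γ zs vs
  | _, _ => []
/-- The join of the flattened values, padded to size `z`. -/
def Val.flattenJoin (Γ : Env K) (z : ℕ) : List (Val K) → List (Bit K)
  | [] => List.replicate z .indet
  | v :: vs =>
      List.zipWith Bit.join (resize z .indet (Val.flatten Γ v)) (Val.flattenJoin Γ z vs)
end

mutual
/-- Convert a value to a memory tree with the permissions `γs`. -/
def Val.toTree (Γ : Env K) (γs : List Perm) : Val K → MTree K
  | .base v => .base v.typeOf (γs.zip (v.flatten Γ))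
  | .array τ vs => .array τ (Val.toTreeList Γ (bitSizeof Γ τ) γs vs)
  | .struct t vs =>
      let τs := (Γ.comps.lookup t).getD []
      .struct t (Val.toTreeFields Γ ((τs.map (bitSizeof Γ)).zip (fieldBitSizes Γ τs)) γs vs)
  | .union t i v =>
      .union t i (Val.toTree Γ (slice 0 (bitSizeof Γ v.typeOf) γs) v)
        ((slice (bitSizeof Γ v.typeOf) (bitSizeof Γ (.union t)) γs).map fun γ => (γ, .indet))
  | .unionAll t vs => .unionAll t (γs.zip (Val.flattenJoin Γ (bitSizeof Γ (.union t)) vs))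
/-- Convert consecutive values of bit size `s`. -/
def Val.toTreeList (Γ : Env K) (s : ℕ) (γs : List Perm) : List (Val K) → List (MTree K)
  | [] => []
  | v :: vs => Val.toTree Γ (γs.take s) v :: Val.toTreeList Γ s (γs.drop s) vs
/-- Convert consecutive values of bit sizes `s`, which with their padding have bit sizes `z`, for
the pairs `(s, z)` of the given list. -/
def Val.toTreeFields (Γ : Env K) (szs : List (ℕ × ℕ)) (γs : List Perm) :
    List (Val K) → List (MTree K × List (PBit K))
  | [] => []
  | v :: vs =>
      match szs with
      | [] => []
      | (s, z) :: szs =>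
          (Val.toTree Γ (γs.take s) v, (slice s z γs).map fun γ => (γ, .indet)) ::
            Val.toTreeFields Γ szs (γs.drop z) vs
end

mutual
/-- Convert a memory tree to a value. -/
def MTree.toVal (Γ : Env K) : MTree K → Val K
  | .base τ bs => .base (BaseVal.unflatten Γ τ (bs.map Prod.snd))
  | .array τ ws => .array τ (MTree.toValList Γ ws)
  | .struct t fs => .struct t (MTree.toValFields Γ fs)
  | .union t i w _ => .union t i (MTree.toVal Γ w)
  | .unionAll t bs => Val.unflatten Γ (.union t) (bs.map Prod.snd)
def MTree.toValList (Γ : Env K) : List (MTree K) → List (Val K)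
  | [] => []
  | w :: ws => MTree.toVal Γ w :: MTree.toValList Γ ws
def MTree.toValFields (Γ : Env K) : List (MTree K × List (PBit K)) → List (Val K)
  | [] => []
  | (w, _) :: fs => MTree.toVal Γ w :: MTree.toValFields Γ fs
end

/-! ### Memory operations -/

open Classical in
/-- The value stored at an address. Fails if the tree lookup fails or if the permissions do not
allow reading. -/
def Mem.lookupVal (Γ : Env K) (a : Addr K) (m : Mem K) : Option (Val K) :=
  match Mem.treeLookup Γ a m with
  | some w =>
      if ∀ b ∈ w.flatten, PermKind.Le (some .readable) b.1.kind then some (w.toVal Γ) else none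
  | none => none

/-- The effect of a read access on the effective types: it makes the variants of unions on the
path of the address the current ones. -/
def Mem.force (Γ : Env K) (a : Addr K) (m : Mem K) : Mem K :=
  match m.lookup a.index with
  | some (.live w μ) => m.insert a.index (.live (MTree.alter Γ (fun w' => w') (a.nref Γ) w) μ)
  | _ => m

/-- Store the value `v` at address `a`, retaining the permissions. -/
def Mem.store (Γ : Env K) (a : Addr K) (v : Val K) (m : Mem K) : Mem K :=
  Mem.alter Γ (fun w => Val.toTree Γ (w.flatten.map Prod.fst) v) a m

end Values

end CH2O

end

/-!
Because neither address has type `unsigned char`, neither is a byte address: an access through `a`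
acts on the memory tree exactly along its normalized reference. If the two addresses have the same
object identifier, both references start at the same object type, and they are compared as lists.

* If one is a prefix of the other, splitting the longer reference shows that one type is a subobject
  type of the other (`subobjectType_of_nref_prefix`). A normalized reference may end with an array
  index one past the end, so this has to go through the original, in-bounds reference.
* Otherwise they share a prefix after which they take different segments out of one and the same
  type. Different array elements or struct fields make the addresses disjoint.
* There remain two different variants of one union. An access along the first reference leaves the
  variant it selects as the specified one (`lookup_alter_of_diverge`), and the second reference
  enters the union through a frozen segment for another variant, so its lookup fails.

The last step holds for arbitrary memory trees. Typing enters only to know that the variants exist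
and that both references leave the common prefix at the same type; for this it is enough to follow
references through types by the partial function `Ref.target`, which ignores array bounds.
-/

noncomputable section

namespace CH2O

universe u

variable {K : Type u}

/-! ### The target type of a reference -/

open Classical in
/-- The type that a reference segment leads to from a given type. Array indices are not required to
be within bounds, so that normalized references one past the end of an array are covered. -/
def RefSeg.target (Γ : Env K) : RefSeg K → Ty K → Option (Ty K)
  | .array _ σ n, τ => if τ = .array σ n then some σ else none
  | .struct i t, τ => if τ = .struct t then Γ.field t i else none
  | .union i t _, τ => if τ = .union t then Γ.field t i else none

/-- The type that a reference leads to from a given type, array bounds being ignored. -/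
def Ref.target (Γ : Env K) : Ref K → Ty K → Option (Ty K)
  | [], τ => some τ
  | s :: r, τ => (s.target Γ τ).bind (Ref.target Γ r)

/-- Two different frozen segments that lead somewhere from the same type are different elements of
one array, different fields of one struct, or different variants of one union. -/
theorem RefSeg.cases_of_ne {Γ : Env K} {s₁ s₂ : RefSeg K} {τ σ₁ σ₂ : Ty K} (hne : s₁ ≠ s₂)
    (hf₁ : s₁.freeze = s₁) (hf₂ : s₂.freeze = s₂) (h₁ : s₁.target Γ τ = some σ₁)
    (h₂ : s₂.target Γ τ = some σ₂) :
    (∃ i j σ n, i ≠ j ∧ s₁ = .array i σ n ∧ s₂ = .array j σ n) ∨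
    (∃ i j t, i ≠ j ∧ s₁ = .struct i t ∧ s₂ = .struct j t) ∨
    (∃ i j t, i ≠ j ∧ s₁ = .union i t .frozen ∧ s₂ = .union j t .frozen ∧
      Γ.field t i = some σ₁ ∧ Γ.field t j = some σ₂) := by
  cases s₁ <;> cases s₂ <;> simp_all [RefSeg.target, RefSeg.freeze]

theorem Ref.target_append (Γ : Env K) (r₁ r₂ : Ref K) (τ : Ty K) :
    Ref.target Γ (r₁ ++ r₂) τ = (Ref.target Γ r₁ τ).bind (Ref.target Γ r₂) := by
  induction r₁ generalizing τ with
  | nil => rfl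
  | cons s r₁ ih =>
    simp only [List.cons_append, Ref.target]
    cases s.target Γ τ with
    | none => rfl
    | some τ' => exact ih τ'

theorem RefTyped.target_eq {Γ : Env K} {r : Ref K} {τ σ : Ty K} (h : RefTyped Γ r τ σ) :
    Ref.target Γ r τ = some σ := by
  induction h with
  | nil => rfl
  | array _ _ ih => simp [Ref.target_append, ih, Ref.target, RefSeg.target]
  | struct _ h₁ h₂ ih =>
    simp [Ref.target_append, ih, Ref.target, RefSeg.target, Env.field, h₁, h₂]
  | union _ h₁ h₂ ih =>
    simp [Ref.target_append, ih, Ref.target, RefSeg.target, Env.field, h₁, h₂]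

theorem RefTyped.split {Γ : Env K} {r : Ref K} {τ σ : Ty K} (h : RefTyped Γ r τ σ)
    {r₁ r₂ : Ref K} (hr : r = r₁ ++ r₂) :
    ∃ σ', RefTyped Γ r₁ τ σ' ∧ RefTyped Γ r₂ σ' σ := by
  induction h generalizing r₂ with
  | nil =>
    obtain ⟨rfl, rfl⟩ := List.nil_eq_append_iff.1 hr
    exact ⟨_, .nil, .nil⟩
  | array h hi ih =>
    rcases List.eq_nil_or_concat r₂ with rfl | ⟨r₃, s, rfl⟩
    · rw [List.append_nil] at hr
      exact ⟨_, hr ▸ .array h hi, .nil⟩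
    · rw [List.concat_eq_append, ← List.append_assoc] at hr
      obtain ⟨hr, hs⟩ := List.append_inj' hr rfl
      obtain ⟨σ', h₁, h₂⟩ := ih hr
      rw [List.concat_eq_append, ← hs]
      exact ⟨σ', h₁, .array h₂ hi⟩
  | struct h ht hi ih =>
    rcases List.eq_nil_or_concat r₂ with rfl | ⟨r₃, s, rfl⟩
    · rw [List.append_nil] at hr
      exact ⟨_, hr ▸ .struct h ht hi, .nil⟩
    · rw [List.concat_eq_append, ← List.append_assoc] at hr
      obtain ⟨hr, hs⟩ := List.append_inj' hr rfl
      obtain ⟨σ', h₁, h₂⟩ := ih hr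
      rw [List.concat_eq_append, ← hs]
      exact ⟨σ', h₁, .struct h₂ ht hi⟩
  | union h ht hi ih =>
    rcases List.eq_nil_or_concat r₂ with rfl | ⟨r₃, s, rfl⟩
    · rw [List.append_nil] at hr
      exact ⟨_, hr ▸ .union h ht hi, .nil⟩
    · rw [List.concat_eq_append, ← List.append_assoc] at hr
      obtain ⟨hr, hs⟩ := List.append_inj' hr rfl
      obtain ⟨σ', h₁, h₂⟩ := ih hr
      rw [List.concat_eq_append, ← hs]
      exact ⟨σ', h₁, .union h₂ ht hi⟩

/-! ### Changing the final array index of a reference -/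

theorem Ref.setOffset_append {r₂ : Ref K} (hr : r₂ ≠ []) (j : ℕ) (r₁ : Ref K) :
    Ref.setOffset j (r₁ ++ r₂) = r₁ ++ Ref.setOffset j r₂ := by
  obtain ⟨r, s, rfl⟩ := (List.eq_nil_or_concat r₂).resolve_left hr
  rw [List.concat_eq_append, ← List.append_assoc]
  cases s <;> simp [Ref.setOffset, ← List.append_assoc]

theorem Ref.target_setOffset (Γ : Env K) (j : ℕ) (r : Ref K) (τ : Ty K) :
    Ref.target Γ (Ref.setOffset j r) τ = Ref.target Γ r τ := by
  rcases List.eq_nil_or_concat r with rfl | ⟨r, s, rfl⟩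
  · rfl
  · rw [List.concat_eq_append]
    cases s <;> simp [Ref.setOffset, Ref.target_append, Ref.target, RefSeg.target]

theorem Ref.freeze_setOffset (j : ℕ) (r : Ref K) :
    Ref.freeze (Ref.setOffset j r) = Ref.setOffset j (Ref.freeze r) := by
  rcases List.eq_nil_or_concat r with rfl | ⟨r, s, rfl⟩
  · rfl
  · rw [List.concat_eq_append]
    cases s <;> simp [Ref.setOffset, Ref.freeze, RefSeg.freeze]

theorem Ref.setOffset_zero_setOffset {r : Ref K} (hr : Ref.offset r = 0) (j : ℕ) :
    Ref.setOffset 0 (Ref.setOffset j r) = r := by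
  rcases List.eq_nil_or_concat r with rfl | ⟨r, s, rfl⟩
  · rfl
  · rw [List.concat_eq_append] at *
    cases s with
    | array i τ n =>
      obtain rfl : i = 0 := by simpa [Ref.offset] using hr
      simp [Ref.setOffset]
    | struct i t => simp [Ref.setOffset]
    | union i t q => simp [Ref.setOffset]

/-! ### Comparing lists -/

/-- Two lists are comparable as prefixes, or they diverge after a common prefix. -/
theorem prefix_or_prefix_or_diverge {A : Type*} (l₁ l₂ : List A) :
    l₁ <+: l₂ ∨ l₂ <+: l₁ ∨
      ∃ l x₁ x₂ l₁' l₂', x₁ ≠ x₂ ∧ l₁ = l ++ x₁ :: l₁' ∧ l₂ = l ++ x₂ :: l₂' := by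
  induction l₁ generalizing l₂ with
  | nil => exact .inl (List.nil_prefix)
  | cons x l₁ ih =>
    cases l₂ with
    | nil => exact .inr (.inl List.nil_prefix)
    | cons y l₂ =>
      by_cases hxy : x = y
      · subst hxy
        rcases ih l₂ with h | h | ⟨l, x₁, x₂, l₁', l₂', hne, rfl, rfl⟩
        · exact .inl (by simpa using h)
        · exact .inr (.inl (by simpa using h))
        · exact .inr (.inr ⟨x :: l, x₁, x₂, l₁', l₂', hne, rfl, rfl⟩)
      · exact .inr (.inr ⟨[], x, y, l₁, l₂, hxy, rfl, rfl⟩)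

/-! ### Lookup after alteration -/

section Trees

variable [LinearOrder K] [ImplEnv K]

/-- Looking up the segment along which a tree has just been altered yields, if anything, an altered
subtree: alteration makes the selected variant of a union the specified one. -/
theorem MTree.exists_of_lookupSeg_alterSeg {Γ : Env K} {g : MTree K → MTree K} {s : RefSeg K}
    {w w' : MTree K} (h : MTree.lookupSeg Γ s (MTree.alterSeg Γ g s w) = some w') :
    ∃ w₀, w' = g w₀ := by
  cases s with
  | array i τ n =>
    cases w with
    | array τ' ws =>
      by_cases hτ : τ = τ'
      · simp only [MTree.alterSeg, MTree.lookupSeg, hτ, if_true, List.getElem?_modify_eq,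
          Option.map_eq_map, Option.map_eq_some_iff] at h
        obtain ⟨w₀, -, h⟩ := h
        exact ⟨w₀, h.symm⟩
      · simp [MTree.alterSeg, MTree.lookupSeg, hτ] at h
    | _ => simp [MTree.alterSeg, MTree.lookupSeg] at h
  | struct i t =>
    cases w with
    | struct t' fs =>
      by_cases ht : t = t'
      · simp only [MTree.alterSeg, MTree.lookupSeg, ht, if_true, List.getElem?_modify_eq,
          Option.map_eq_map, Option.map_eq_some_iff] at h
        obtain ⟨_, ⟨f, -, rfl⟩, h⟩ := h
        exact ⟨f.1, h.symm⟩
      · simp [MTree.alterSeg, MTree.lookupSeg, ht] at h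
    | _ => simp [MTree.alterSeg, MTree.lookupSeg] at h
  | union i t q =>
    cases w with
    | union t' j w bs =>
      by_cases ht : t = t'
      · by_cases hij : i = j
        · simp only [MTree.alterSeg, MTree.lookupSeg, ht, hij, if_true, Option.some.injEq] at h
          exact ⟨w, h.symm⟩
        · cases hfd : Γ.field t i with
          | none =>
            subst ht
            cases q <;> simp [MTree.alterSeg, MTree.lookupSeg, hij, hfd] at h
          | some τ =>
            subst ht
            simp only [MTree.alterSeg, MTree.lookupSeg, hij, hfd, if_true, if_false,
              Option.some.injEq] at h
            exact ⟨_, h.symm⟩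
      · simp [MTree.alterSeg, MTree.lookupSeg, ht] at h
    | unionAll t' bs =>
      by_cases ht : t = t'
      · subst ht
        cases hfd : Γ.field t i with
        | none => simp [MTree.alterSeg, MTree.lookupSeg, hfd] at h
        | some τ =>
          simp only [MTree.alterSeg, MTree.lookupSeg, hfd, if_true, Option.some.injEq] at h
          exact ⟨_, h.symm⟩
      · simp [MTree.alterSeg, MTree.lookupSeg, ht] at h
    | _ => simp [MTree.alterSeg, MTree.lookupSeg] at h

/-- Once a tree has been altered along an existing variant of a union, a frozen segment for another
variant of that union selects nothing. -/
theorem MTree.lookupSeg_alterSeg_union {Γ : Env K} {t : Tag} {i j : ℕ} {τ : Ty K} (hij : i ≠ j)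
    (hj : Γ.field t j = some τ) (q : Frozenness) (g : MTree K → MTree K) (w : MTree K) :
    MTree.lookupSeg Γ (.union i t .frozen) (MTree.alterSeg Γ g (.union j t q) w) = none := by
  cases w with
  | union t' k w bs =>
    by_cases ht : t = t'
    · subst ht
      by_cases hjk : j = k
      · subst hjk
        simp [MTree.alterSeg, MTree.lookupSeg, hij]
      · simp [MTree.alterSeg, MTree.lookupSeg, hij, hjk, hj]
    · simp [MTree.alterSeg, MTree.lookupSeg, ht]
  | unionAll t' bs =>
    by_cases ht : t = t'
    · subst ht
      simp [MTree.alterSeg, MTree.lookupSeg, hij, hj]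
    · simp [MTree.alterSeg, MTree.lookupSeg, ht]
  | _ => simp [MTree.alterSeg, MTree.lookupSeg]

/-- Lookup fails after alteration along a reference that, behind a common prefix, selects another
variant of the same union. -/
theorem MTree.lookup_alter_of_diverge {Γ : Env K} {t : Tag} {i j : ℕ} {τ : Ty K} (hij : i ≠ j)
    (hj : Γ.field t j = some τ) (q : Frozenness) (r r₁ r₂ : Ref K) (f : MTree K → MTree K)
    (w : MTree K) :
    MTree.lookup Γ (r ++ .union i t .frozen :: r₁)
      (MTree.alter Γ f (r ++ .union j t q :: r₂) w) = none := by
  induction r generalizing w with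
  | nil =>
    simp only [List.nil_append, MTree.lookup, MTree.alter,
      MTree.lookupSeg_alterSeg_union hij hj, Option.bind_none]
  | cons s r ih =>
    simp only [List.cons_append, MTree.lookup, MTree.alter, Option.bind_eq_none_iff]
    intro w' hw'
    obtain ⟨w₀, rfl⟩ := MTree.exists_of_lookupSeg_alterSeg hw'
    exact ih w₀

/-! ### Reading from a memory after another access -/

theorem Mem.lookupVal_eq_none_of_not_live {Γ : Env K} {a : Addr K} {m : Mem K}
    (h : ∀ w μ, m.lookup a.index ≠ some (.live w μ)) : Mem.lookupVal Γ a m = none := by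
  have : Mem.treeLookup Γ a m = none := by
    unfold Mem.treeLookup
    split
    · exact absurd ‹_› (h _ _)
    · rfl
  simp [Mem.lookupVal, this]

theorem Mem.lookupVal_insert_eq_none {Γ : Env K} {a : Addr K} {w : MTree K}
    (h : MTree.lookup Γ (a.nref Γ) w = none) (o : ObjId) (ho : a.index = o) (μ : Bool)
    (m : Mem K) :
    Mem.lookupVal Γ a (m.insert o (.live w μ)) = none := by
  subst ho
  simp [Mem.lookupVal, Mem.treeLookup, h]

theorem Mem.lookupVal_force_eq_none {Γ : Env K} {a₁ a₂ : Addr K} (hi : a₁.index = a₂.index)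
    (h : ∀ f w, MTree.lookup Γ (a₁.nref Γ) (MTree.alter Γ f (a₂.nref Γ) w) = none) (m : Mem K) :
    Mem.lookupVal Γ a₁ (Mem.force Γ a₂ m) = none := by
  unfold Mem.force
  split
  · exact Mem.lookupVal_insert_eq_none (h _ _) _ hi _ _
  · rename_i hm
    exact Mem.lookupVal_eq_none_of_not_live (hi ▸ hm)

theorem Mem.lookupVal_store_eq_none {Γ : Env K} {a₁ a₂ : Addr K} (hi : a₁.index = a₂.index)
    (h : ∀ f w, MTree.lookup Γ (a₁.nref Γ) (MTree.alter Γ f (a₂.nref Γ) w) = none) (v : Val K)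
    (m : Mem K) :
    Mem.lookupVal Γ a₁ (Mem.store Γ a₂ v m) = none := by
  unfold Mem.store Mem.alter
  split
  · split <;> exact Mem.lookupVal_insert_eq_none (h _ _) _ hi _ _
  · rename_i hm
    exact Mem.lookupVal_eq_none_of_not_live (hi ▸ hm)

/-! ### Normalized references of typed addresses -/

theorem AddrTyped.subTy_eq {Γ : Env K} {Δ : MemEnv K} {a : Addr K} {σ : Ty K}
    (h : AddrTyped Γ Δ a (.type σ)) (hσ : σ ≠ uchar) : a.subTy = σ := by
  obtain ⟨-, -, -, -, -, -, hc, he⟩ := h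
  rw [he] at hc
  cases hc with
  | self => rfl
  | uchar => exact absurd rfl hσ

theorem AddrTyped.target_nref {Γ : Env K} {Δ : MemEnv K} {a : Addr K} {σp : PtrType K}
    (h : AddrTyped Γ Δ a σp) : Ref.target Γ (a.nref Γ) a.objTy = some a.subTy := by
  rw [Addr.nref, Ref.target_setOffset, h.2.2.1.target_eq]

theorem Addr.Frozen.freeze_nref {a : Addr K} (h : a.Frozen) (Γ : Env K) :
    Ref.freeze (a.nref Γ) = a.nref Γ := by
  have : Ref.freeze a.ref = a.ref := congrArg Addr.ref h
  rw [Addr.nref, Ref.freeze_setOffset, this]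

theorem AddrTyped.objTy_eq {Γ : Env K} {Δ : MemEnv K} {a₁ a₂ : Addr K} {σ₁ σ₂ : PtrType K}
    (h₁ : AddrTyped Γ Δ a₁ σ₁) (h₂ : AddrTyped Γ Δ a₂ σ₂) (hi : a₁.index = a₂.index) :
    a₁.objTy = a₂.objTy := by
  obtain ⟨⟨β₁, h₁⟩, -⟩ := h₁
  obtain ⟨⟨β₂, h₂⟩, -⟩ := h₂
  rw [hi, h₂] at h₁
  exact ((Prod.mk.inj (Option.some.inj h₁)).1).symm

theorem subobjectType_of_nref_prefix {Γ : Env K} {Δ : MemEnv K} {a₁ a₂ : Addr K}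
    {σ₁ σ₂ : PtrType K} (h₁ : AddrTyped Γ Δ a₁ σ₁) (h₂ : AddrTyped Γ Δ a₂ σ₂)
    (hi : a₁.index = a₂.index) (h : a₁.nref Γ <+: a₂.nref Γ) :
    SubobjectType Γ a₂.subTy a₁.subTy := by
  obtain ⟨r, hr⟩ := h
  have ht₁ := h₁.target_nref
  rw [h₁.objTy_eq h₂ hi] at ht₁
  by_cases hnil : r = []
  · have ht₂ := h₂.target_nref
    rw [← hr, hnil, List.append_nil, ht₁] at ht₂
    rw [Option.some.inj ht₂]
    exact ⟨[], .nil⟩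
  · -- The index at the end of `a₂.nref Γ` may be out of bounds; resetting it to `0` recovers
    -- `a₂.ref` without touching the proper prefix `a₁.nref Γ`.
    have href : a₂.ref = a₁.nref Γ ++ Ref.setOffset 0 r := by
      rw [← Ref.setOffset_append hnil, hr]
      exact (Ref.setOffset_zero_setOffset h₂.2.2.2.1 _).symm
    obtain ⟨σ', hσ₁, hσ₂⟩ := h₂.2.2.1.split href
    obtain rfl : σ' = a₁.subTy := Option.some.inj (hσ₁.target_eq.symm.trans ht₁)
    exact ⟨_, hσ₂⟩

end Trees

end CH2O

end

theorem theorem1 {K : Type*} [LinearOrder K] [CH2O.ImplEnv K]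
    (Γ : CH2O.Env K) (Δ : CH2O.MemEnv K) (m : CH2O.Mem K)
    (a₁ a₂ : CH2O.Addr K) (σ₁ σ₂ : CH2O.Ty K)
    (hΓ : CH2O.EnvValid Γ) (hm : CH2O.MemValid Γ Δ m)
    (hf₁ : a₁.Frozen) (hf₂ : a₂.Frozen)
    (ha₁ : CH2O.AddrTyped Γ Δ a₁ (.type σ₁)) (ha₂ : CH2O.AddrTyped Γ Δ a₂ (.type σ₂))
    (hσ₁ : σ₁ ≠ CH2O.uchar) (hσ₂ : σ₂ ≠ CH2O.uchar) :
    (CH2O.SubobjectType Γ σ₁ σ₂ ∨ CH2O.SubobjectType Γ σ₂ σ₁) ∨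
    CH2O.Addr.Disjoint Γ a₁ a₂ ∨
    ((CH2O.Mem.lookupVal Γ a₁ (CH2O.Mem.force Γ a₂ m) = none ∧
        CH2O.Mem.lookupVal Γ a₂ (CH2O.Mem.force Γ a₁ m) = none) ∧
      ∀ v₁ v₂ : CH2O.Val K,
        CH2O.Mem.lookupVal Γ a₁ (CH2O.Mem.store Γ a₂ v₁ m) = none ∧
        CH2O.Mem.lookupVal Γ a₂ (CH2O.Mem.store Γ a₁ v₂ m) = none) := by
  by_cases hi : a₁.index = a₂.index
  swap
  · exact .inr (.inl (.index hi))
  rcases CH2O.prefix_or_prefix_or_diverge (a₁.nref Γ) (a₂.nref Γ) with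
    h | h | ⟨r, s₁, s₂, r₁, r₂, hne, hr₁, hr₂⟩
  · have := CH2O.subobjectType_of_nref_prefix ha₁ ha₂ hi h
    rw [ha₁.subTy_eq hσ₁, ha₂.subTy_eq hσ₂] at this
    exact .inl (.inr this)
  · have := CH2O.subobjectType_of_nref_prefix ha₂ ha₁ hi.symm h
    rw [ha₁.subTy_eq hσ₁, ha₂.subTy_eq hσ₂] at this
    exact .inl (.inl this)
  have ht₁ := ha₁.target_nref
  have ht₂ := ha₂.target_nref
  rw [hr₁, ha₁.objTy_eq ha₂ hi, CH2O.Ref.target_append, Option.bind_eq_some_iff] at ht₁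
  rw [hr₂, CH2O.Ref.target_append, Option.bind_eq_some_iff] at ht₂
  obtain ⟨τ, hτ, ht₁⟩ := ht₁
  obtain ⟨τ', hτ', ht₂⟩ := ht₂
  obtain rfl : τ = τ' := Option.some.inj (hτ.symm.trans hτ')
  obtain ⟨τ₁, hs₁, -⟩ := Option.bind_eq_some_iff.1 ht₁
  obtain ⟨τ₂, hs₂, -⟩ := Option.bind_eq_some_iff.1 ht₂
  have hz₁ : s₁.freeze = s₁ := by
    have := hf₁.freeze_nref Γ
    rw [hr₁, CH2O.Ref.freeze, List.map_append] at this
    exact (List.cons.inj (List.append_inj this (by simp)).2).1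
  have hz₂ : s₂.freeze = s₂ := by
    have := hf₂.freeze_nref Γ
    rw [hr₂, CH2O.Ref.freeze, List.map_append] at this
    exact (List.cons.inj (List.append_inj this (by simp)).2).1
  rcases CH2O.RefSeg.cases_of_ne hne hz₁ hz₂ hs₁ hs₂ with
    ⟨i, j, σ, n, hij, rfl, rfl⟩ | ⟨i, j, t, hij, rfl, rfl⟩ | ⟨i, j, t, hij, rfl, rfl, hti, htj⟩
  · exact .inr (.inl (.ref hi (by rw [hr₁, hr₂]; exact .array rfl hij)))
  · exact .inr (.inl (.ref hi (by rw [hr₁, hr₂]; exact .struct rfl hij)))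
  · have h₁ : ∀ f w, CH2O.MTree.lookup Γ (a₁.nref Γ)
        (CH2O.MTree.alter Γ f (a₂.nref Γ) w) = none := fun f w => by
      rw [hr₁, hr₂]
      exact CH2O.MTree.lookup_alter_of_diverge hij htj _ _ _ _ _ _
    have h₂ : ∀ f w, CH2O.MTree.lookup Γ (a₂.nref Γ)
        (CH2O.MTree.alter Γ f (a₁.nref Γ) w) = none := fun f w => by
      rw [hr₁, hr₂]
      exact CH2O.MTree.lookup_alter_of_diverge hij.symm hti _ _ _ _ _ _
    exact .inr (.inr ⟨⟨CH2O.Mem.lookupVal_force_eq_none hi h₁ m,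
      CH2O.Mem.lookupVal_force_eq_none hi.symm h₂ m⟩, fun v₁ v₂ =>
      ⟨CH2O.Mem.lookupVal_store_eq_none hi h₁ v₁ m,
        CH2O.Mem.lookupVal_store_eq_none hi.symm h₂ v₂ m⟩⟩)
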